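/- \textbf{Theorem.} Let $N_1,N_2\ge 2$ be integers, and for $i=1,2$ let $(p_{i,1},\dots,p_{i,N_i})$ be a probability vector with all entries positive; put $q_{i,j}=\sum_{\ell=1}^{j-1}p_{i,\ell}$. Let $\mathcal D\subset\{1,\dots,N_1\}\times\{1,\dots,N_2\}$ with $1<|\mathcal D|<N_1N_2$. For $w=(j_1,j_2)\in\mathcal D$ define $\psi_w:\mathbb R^2\to\mathbb R^2$ by $$\psi_w(x_1,x_2)=(p_{1,j_1}x_1+q_{1,j_1},\;p_{2,j_2}x_2+q_{2,j_2}),$$ and let $K$ be the associated Bara\'nski carpet, i.e. the unique nonempty compact set with $K=\bigcup_{w\in\mathcal D}\psi_w(K)$. For a word $\mathbf i=i_1\cdots i_n\in\mathcal D^n$ write $\psi_{\mathbf i}=\psi_{i_1}\circ\cdots\circ\psi_{i_n}$. A point $x$ of a connected space $X$ is a \emph{cut point} of $X$ if $X\setminus\{x\}$ is disconnected; a point $x$ of a space $X$ is a \emph{local cut point} of $X$ if $x$ is a cut point of some connected neighbourhood of $x$ in $X$. Suppose that $K$ is connected and has no cut points. Then $K$ has a local cut point if and only if, for $n=1$ or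 $n=2$, there are disjoint subsets $\mathcal I,\mathcal J\subset\mathcal D^n$ and a point $x$ such that $$\Big(\bigcup_{\mathbf i\in\mathcal I}\psi_{\mathbf i}(K)\Big)\cap\Big(\bigcup_{\mathbf i\in\mathcal J}\psi_{\mathbf i}(K)\Big)=\{x\}\quad\text{and}\quad \mathcal I\cup\mathcal J=\{\mathbf i\in\mathcal D^n:\ x\in\psi_{\mathbf i}(K)\}.$$ -/

import Mathlib

open Set Filter Topology

/-- `x` is a cut point of the connected set `S`: removing `x` disconnects `S`. -/
def IsCutPoint {X : Type*} [TopologicalSpace X] (S : Set X) (x : X) : Prop :=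
  IsConnected S ∧ x ∈ S ∧ ¬ IsPreconnected (S \ {x})

/-- `x` is a local cut point of the space `S`: it is a cut point of some connected neighbourhood
`U` of `x` in `S` (with the subspace topology; `U` need not be open). -/
def IsLocalCutPoint {X : Type*} [TopologicalSpace X] (S : Set X) (x : X) : Prop :=
  ∃ U : Set X, U ⊆ S ∧ U ∈ 𝓝[S] x ∧ IsCutPoint U x

/-- The data defining a Barański carpet: two probability vectors `p` (column widths) and `r`
(row heights) with positive entries and lengths at least two, and a set `D` of digits
`(column, row)`, which has more than one element and is not the full grid. Columns and rows are
numbered from `0`. -/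
structure BaranskiData where
  N : ℕ
  M : ℕ
  two_le_N : 2 ≤ N
  two_le_M : 2 ≤ M
  p : Fin N → ℝ
  r : Fin M → ℝ
  p_pos : ∀ j, 0 < p j
  r_pos : ∀ j, 0 < r j
  p_sum : ∑ j, p j = 1
  r_sum : ∑ j, r j = 1
  D : Finset (Fin N × Fin M)
  one_lt_card : 1 < D.card
  card_lt : D.card < N * M

namespace BaranskiData

variable (B : BaranskiData)

/-- The affine map `ψ_w` of the digit `w = (a, b)`, mapping the unit square onto the rectangle
in column `a` and row `b`. -/
def digitMap (w : B.D) (x : ℝ × ℝ) : ℝ × ℝ :=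
  (B.p w.1.1 * x.1 + ∑ l ∈ Finset.Iio w.1.1, B.p l,
   B.r w.1.2 * x.2 + ∑ l ∈ Finset.Iio w.1.2, B.r l)

/-- The sets `Q_n`: `Q_0` is the unit square and `Q_{n+1} = ⋃_{w ∈ D} ψ_w(Q_n)`. -/
def approx : ℕ → Set (ℝ × ℝ)
  | 0 => Icc (0 : ℝ) 1 ×ˢ Icc (0 : ℝ) 1
  | n + 1 => ⋃ w : B.D, B.digitMap w '' approx n

/-- The Barański carpet, the attractor of the maps `ψ_w`, `w ∈ D`. It is the unique nonempty
compact set `K` with `K = ⋃_{w ∈ D} ψ_w(K)`; see `carpet_nonempty`, `isCompact_carpet`,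
`carpet_eq_iUnion` and `eq_carpet`. -/
def carpet : Set (ℝ × ℝ) := ⋂ n, B.approx n

/-- Words of length `n` over the digit set. -/
abbrev Word (n : ℕ) : Type := Fin n → B.D

/-- `ψ_w = ψ_{w_1} ∘ ⋯ ∘ ψ_{w_n}` for a word `w = w_1 ⋯ w_n`; the identity for `n = 0`. -/
def wordMap : (n : ℕ) → B.Word n → ℝ × ℝ → ℝ × ℝ
  | 0, _ => id
  | n + 1, w => B.digitMap (w 0) ∘ wordMap n (Fin.tail w)

/-- The level-`n` cell `ψ_w(K)` of a word `w` of length `n`. -/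
def cell {n : ℕ} (w : B.Word n) : Set (ℝ × ℝ) := B.wordMap n w '' B.carpet

theorem continuous_digitMap (w : B.D) : Continuous (B.digitMap w) := by
  unfold digitMap
  fun_prop

theorem digitMap_injective (w : B.D) : Function.Injective (B.digitMap w) := by
  intro x y h
  simp only [digitMap, Prod.mk.injEq, add_left_inj, mul_eq_mul_left_iff,
    (B.p_pos _).ne', (B.r_pos _).ne', or_false] at h
  exact Prod.ext h.1 h.2

theorem add_sum_Iio_le {n : ℕ} (p : Fin n → ℝ) (hp : ∀ j, 0 < p j) (hs : ∑ j, p j = 1)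
    (a : Fin n) : p a + ∑ l ∈ Finset.Iio a, p l ≤ 1 := by
  rw [← hs, ← Finset.sum_insert (by simp)]
  exact Finset.sum_le_sum_of_subset_of_nonneg (Finset.subset_univ _) fun i _ _ => (hp i).le

theorem approx_succ_subset (n : ℕ) : B.approx (n + 1) ⊆ B.approx n := by
  induction n with
  | zero =>
    intro y hy
    obtain ⟨w, x, ⟨hx1, hx2⟩, rfl⟩ := mem_iUnion.1 hy
    have h1 := add_sum_Iio_le B.p B.p_pos B.p_sum w.1.1
    have h2 := add_sum_Iio_le B.r B.r_pos B.r_sum w.1.2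
    have h3 : 0 ≤ ∑ l ∈ Finset.Iio w.1.1, B.p l := Finset.sum_nonneg fun i _ => (B.p_pos i).le
    have h4 : 0 ≤ ∑ l ∈ Finset.Iio w.1.2, B.r l := Finset.sum_nonneg fun i _ => (B.r_pos i).le
    have h5 := B.p_pos w.1.1
    have h6 := B.r_pos w.1.2
    refine ⟨⟨?_, ?_⟩, ⟨?_, ?_⟩⟩ <;> simp only [digitMap]
    · exact add_nonneg (mul_nonneg h5.le hx1.1) h3
    · nlinarith [hx1.2]
    · exact add_nonneg (mul_nonneg h6.le hx2.1) h4
    · nlinarith [hx2.2]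
  | succ n ih => exact iUnion_mono fun w => image_mono ih

theorem isCompact_approx (n : ℕ) : IsCompact (B.approx n) := by
  induction n with
  | zero => exact isCompact_Icc.prod isCompact_Icc
  | succ n ih => exact isCompact_iUnion fun w => ih.image (B.continuous_digitMap w)

theorem nonempty_D : Nonempty B.D := by
  have h := B.one_lt_card
  obtain ⟨w, hw⟩ := Finset.card_pos.1 (by omega : 0 < B.D.card)
  exact ⟨⟨w, hw⟩⟩

theorem nonempty_approx (n : ℕ) : (B.approx n).Nonempty := by
  induction n with
  | zero => exact ⟨(0, 0), by simp [approx]⟩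
  | succ n ih =>
    obtain ⟨w⟩ := B.nonempty_D
    exact nonempty_iUnion.2 ⟨w, ih.image _⟩

theorem antitone_approx : Antitone B.approx := antitone_nat_of_succ_le B.approx_succ_subset

theorem isCompact_carpet : IsCompact B.carpet :=
  (B.isCompact_approx 0).of_isClosed_subset
    (isClosed_iInter fun n => (B.isCompact_approx n).isClosed) (iInter_subset _ 0)

theorem carpet_nonempty : B.carpet.Nonempty :=
  IsCompact.nonempty_iInter_of_sequence_nonempty_isCompact_isClosed _ B.approx_succ_subset
    B.nonempty_approx (B.isCompact_approx 0) fun n => (B.isCompact_approx n).isClosed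

theorem carpet_eq_iUnion : B.carpet = ⋃ w : B.D, B.digitMap w '' B.carpet := by
  apply Subset.antisymm
  · intro x hx
    by_contra hne
    have h : ∀ w : B.D, ∃ n, x ∉ B.digitMap w '' B.approx n := by
      intro w
      by_contra! hw
      apply hne
      refine mem_iUnion.2 ⟨w, ?_⟩
      rw [carpet, (B.digitMap_injective w).injOn.image_iInter_eq]
      exact mem_iInter.2 hw
    choose n hn using h
    obtain ⟨w, hw⟩ := mem_iUnion.1
      (show x ∈ ⋃ w : B.D, B.digitMap w '' B.approx (Finset.univ.sup n) from
        mem_iInter.1 hx (Finset.univ.sup n + 1))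
    exact hn w (image_mono (B.antitone_approx (Finset.le_sup (Finset.mem_univ w))) hw)
  · refine iUnion_subset fun w => subset_iInter fun n => ?_
    refine Subset.trans ?_ (B.approx_succ_subset n)
    exact (image_mono (iInter_subset _ n)).trans
      (subset_iUnion (fun w : B.D => B.digitMap w '' B.approx n) w)

theorem lt_one_of_sum {n : ℕ} (hn : 2 ≤ n) (p : Fin n → ℝ) (hp : ∀ j, 0 < p j)
    (hs : ∑ j, p j = 1) (a : Fin n) : p a < 1 := by
  haveI : Nontrivial (Fin n) := Fin.nontrivial_iff_two_le.2 hn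
  obtain ⟨b, hb⟩ := exists_ne a
  rw [← hs]
  exact Finset.single_lt_sum hb (Finset.mem_univ a) (Finset.mem_univ b) (hp b)
    fun k _ _ => (hp k).le

theorem exists_dist_le (w : B.D) : ∃ c < 1, 0 ≤ c ∧
    ∀ x y, dist (B.digitMap w x) (B.digitMap w y) ≤ c * dist x y := by
  refine ⟨max (B.p w.1.1) (B.r w.1.2),
    max_lt (lt_one_of_sum B.two_le_N _ B.p_pos B.p_sum _)
      (lt_one_of_sum B.two_le_M _ B.r_pos B.r_sum _),
    le_max_of_le_left (B.p_pos _).le, fun x y => ?_⟩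
  rw [Prod.dist_eq]
  refine max_le ?_ ?_
  · simp only [digitMap, Real.dist_eq, add_sub_add_right_eq_sub, ← mul_sub, abs_mul,
      abs_of_pos (B.p_pos _)]
    exact mul_le_mul (le_max_left _ _) (le_max_left _ _) (abs_nonneg _)
      (le_max_of_le_left (B.p_pos _).le)
  · simp only [digitMap, Real.dist_eq, add_sub_add_right_eq_sub, ← mul_sub, abs_mul,
      abs_of_pos (B.r_pos _)]
    exact mul_le_mul (le_max_right _ _) (le_max_right _ _) (abs_nonneg _)
      (le_max_of_le_left (B.p_pos _).le)

theorem subset_of_invariant {A C : Set (ℝ × ℝ)} (hA : IsCompact A) (hC : IsCompact C)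
    (hC0 : C.Nonempty) (hAi : A = ⋃ w : B.D, B.digitMap w '' A)
    (hCi : C = ⋃ w : B.D, B.digitMap w '' C) : A ⊆ C := by
  intro z hz
  obtain ⟨x, hx, hmax⟩ := hA.exists_isMaxOn ⟨z, hz⟩
    (Metric.continuous_infDist_pt C).continuousOn
  have hx' := hx
  rw [hAi] at hx'
  obtain ⟨w, y, hy, rfl⟩ := mem_iUnion.1 hx'
  obtain ⟨k, hk, hyk⟩ := hC.exists_infDist_eq_dist hC0 y
  obtain ⟨c, hc1, hc0, hc⟩ := B.exists_dist_le w
  have hkC : B.digitMap w k ∈ C := by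
    rw [hCi]
    exact mem_iUnion.2 ⟨w, k, hk, rfl⟩
  have h1 := (Metric.infDist_le_dist_of_mem hkC).trans (hc y k)
  have h2 : Metric.infDist y C ≤ Metric.infDist (B.digitMap w y) C := hmax hy
  have h3 : Metric.infDist z C ≤ Metric.infDist (B.digitMap w y) C := hmax hz
  have h4 : 0 ≤ Metric.infDist z C := Metric.infDist_nonneg
  rw [← hyk] at h1
  have h5 : Metric.infDist z C = 0 := by nlinarith
  exact (hC.isClosed.mem_iff_infDist_zero hC0).2 h5

theorem eq_carpet {A : Set (ℝ × ℝ)} (hA : IsCompact A) (hA0 : A.Nonempty)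
    (hAi : A = ⋃ w : B.D, B.digitMap w '' A) : A = B.carpet :=
  Subset.antisymm
    (B.subset_of_invariant hA B.isCompact_carpet B.carpet_nonempty hAi B.carpet_eq_iUnion)
    (B.subset_of_invariant B.isCompact_carpet hA hA0 B.carpet_eq_iUnion hAi)

end BaranskiData

/-! `Splits n x` says that the level-`n` cells through `x` fall into two nonempty classes, with
cells of different classes meeting only at `x`. If `x` cuts a connected neighbourhood `U`, then at a
fine level all cells through `x` lie in `U`. As `K` has no cut point, each such cell stays connected
without `x` and so lies on one side: a splitting of some high level
(`exists_splits_of_isLocalCutPoint`). Conversely, the cells through `x` form a connected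
neighbourhood of `x`, which such a partition cuts (`isLocalCutPoint_of_partition`).

The level drops to two by shortening words of length at least three (`Splits.descend`). A first
digit shared by all words at `x` can be dropped. Otherwise two first digits differ in some
coordinate, where `x` is then a common endpoint of two first level intervals. If in the other
coordinate `x` is an endpoint of a second level interval, then `x` is a corner of every cell
rectangle of the preceding level containing it; the last digit map fixes that corner of the unit
square, so the last digit is redundant. If not, the first two digits in that coordinate are the same
for all words at `x`, while in the first coordinate the second digit map merely fixes an endpoint;
the second digit can be deleted. -/

namespace BaranskiData

/-! ### Affine maps of an interval partition -/

/-- The increasing affine map of `[0, 1]` onto the `a`-th interval of the partition with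
interval lengths `p`. -/
def gridMap {N : ℕ} (p : Fin N → ℝ) (a : Fin N) (s : ℝ) : ℝ :=
  p a * s + ∑ l ∈ Finset.Iio a, p l

/-- The composition of the interval maps along a word. -/
def segMap {N : ℕ} (p : Fin N → ℝ) : (n : ℕ) → (Fin n → Fin N) → ℝ → ℝ
  | 0, _ => id
  | n + 1, w => gridMap p (w 0) ∘ segMap p n (Fin.tail w)

section Interval

variable {N : ℕ} {p : Fin N → ℝ}

theorem gridMap_injective (hp : ∀ j, 0 < p j) (a : Fin N) :
    Function.Injective (gridMap p a) := by
  intro s t h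
  simpa [gridMap, (hp a).ne'] using h

theorem gridMap_mem (hp : ∀ j, 0 < p j) (hs : ∑ j, p j = 1) (a : Fin N) {s : ℝ}
    (h : s ∈ Icc (0 : ℝ) 1) : gridMap p a s ∈ Icc (0 : ℝ) 1 := by
  have h1 := add_sum_Iio_le p hp hs a
  have h2 : 0 ≤ ∑ l ∈ Finset.Iio a, p l := Finset.sum_nonneg fun i _ => (hp i).le
  have h3 := hp a
  unfold gridMap
  exact ⟨add_nonneg (mul_nonneg h3.le h.1) h2, by nlinarith [h.2]⟩

theorem add_sum_Iio_le_sum_Iio (hp : ∀ j, 0 < p j) {a b : Fin N} (hab : a < b) :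
    p a + ∑ l ∈ Finset.Iio a, p l ≤ ∑ l ∈ Finset.Iio b, p l := by
  rw [← Finset.sum_insert (by simp)]
  refine Finset.sum_le_sum_of_subset_of_nonneg ?_ fun i _ _ => (hp i).le
  intro i hi
  rcases Finset.mem_insert.1 hi with rfl | hi
  · simpa using hab
  · exact Finset.mem_Iio.2 ((Finset.mem_Iio.1 hi).trans hab)

theorem gridMap_eq_of_lt (hp : ∀ j, 0 < p j) {a b : Fin N} (hab : a < b) {s t : ℝ}
    (hs : s ∈ Icc (0 : ℝ) 1) (ht : t ∈ Icc (0 : ℝ) 1) (h : gridMap p a s = gridMap p b t) :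
    s = 1 ∧ t = 0 := by
  have h1 := add_sum_Iio_le_sum_Iio hp hab
  have ha := hp a
  have hb := hp b
  unfold gridMap at h
  have h2 : p a * s ≤ p a := by nlinarith [hs.2]
  have h3 : 0 ≤ p b * t := mul_nonneg hb.le ht.1
  constructor
  · have : p a * (1 - s) = 0 := by linarith
    rcases mul_eq_zero.1 this with h | h <;> linarith
  · have : p b * t = 0 := by linarith
    rcases mul_eq_zero.1 this with h | h <;> linarith

/-- Only the last interval reaches 1; `b` is arbitrary, so `b ≤ a` makes `a` the largest index. -/
theorem gridMap_one_unique (hp : ∀ j, 0 < p j) (hs : ∑ j, p j = 1) {a b : Fin N} {s : ℝ}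
    (h : s ∈ Icc (0 : ℝ) 1) (ha : gridMap p a s = 1) : s = 1 ∧ b ≤ a := by
  have h1 := add_sum_Iio_le p hp hs a
  have h0 := hp a
  have hs1 : s = 1 := by
    unfold gridMap at ha
    nlinarith [h.2]
  refine ⟨hs1, ?_⟩
  by_contra! hab
  have h1' := add_sum_Iio_le p hp hs b
  have h2 : gridMap p b 0 ≤ 1 - p b := by
    unfold gridMap
    linarith
  have h3 := add_sum_Iio_le_sum_Iio hp hab
  have hb := hp b
  subst hs1
  unfold gridMap at ha h2
  linarith

theorem gridMap_zero_unique (hp : ∀ j, 0 < p j) {a b : Fin N} {s : ℝ}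
    (h : s ∈ Icc (0 : ℝ) 1) (ha : gridMap p a s = 0) : s = 0 ∧ a ≤ b := by
  have h1 : 0 ≤ ∑ l ∈ Finset.Iio a, p l := Finset.sum_nonneg fun i _ => (hp i).le
  have h0 := hp a
  have h2 := mul_nonneg h0.le h.1
  unfold gridMap at ha
  refine ⟨?_, ?_⟩
  · have : p a * s = 0 := by linarith
    rcases mul_eq_zero.1 this with h | h <;> linarith
  · by_contra! hab
    have h3 : p b ≤ ∑ l ∈ Finset.Iio a, p l :=
      Finset.single_le_sum (f := p) (fun i _ => (hp i).le) (Finset.mem_Iio.2 hab)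
    have := hp b
    linarith

/-! ### Endpoints and coincidences between intervals -/

/-- The endpoints of the unit interval. -/
def IsEnd (t : ℝ) : Prop := t = 0 ∨ t = 1

theorem IsEnd.mem_Icc {t : ℝ} (h : IsEnd t) : t ∈ Icc (0 : ℝ) 1 := by
  rcases h with rfl | rfl <;> simp

/-- A point mapped to an endpoint of the unit interval is fixed. -/
theorem eq_of_gridMap_isEnd (hp : ∀ j, 0 < p j) (hs : ∑ j, p j = 1) {a : Fin N} {s : ℝ}
    (h : s ∈ Icc (0 : ℝ) 1) (he : IsEnd (gridMap p a s)) : gridMap p a s = s := by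
  rcases he with he | he
  · rw [he, (gridMap_zero_unique (b := a) hp h he).1]
  · rw [he, (gridMap_one_unique (b := a) hp hs h he).1]

theorem IsEnd.of_gridMap (hp : ∀ j, 0 < p j) (hs : ∑ j, p j = 1) {a : Fin N} {s : ℝ}
    (h : s ∈ Icc (0 : ℝ) 1) (he : IsEnd (gridMap p a s)) : IsEnd s :=
  eq_of_gridMap_isEnd hp hs h he ▸ he

theorem digit_eq_of_isEnd (hp : ∀ j, 0 < p j) (hs : ∑ j, p j = 1) {a b : Fin N} {s t : ℝ}
    (h : s ∈ Icc (0 : ℝ) 1) (h' : t ∈ Icc (0 : ℝ) 1) (hst : gridMap p a s = gridMap p b t)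
    (he : IsEnd (gridMap p a s)) : a = b := by
  rcases he with he | he
  · exact le_antisymm (gridMap_zero_unique hp h he).2
      (gridMap_zero_unique hp h' (hst ▸ he)).2
  · exact le_antisymm (gridMap_one_unique hp hs h' (hst ▸ he)).2
      (gridMap_one_unique hp hs h he).2

/-- Points of different intervals of the partition coincide only as common endpoints. -/
theorem gridMap_eq_of_ne (hp : ∀ j, 0 < p j) {a b : Fin N} (hab : a ≠ b) {s t : ℝ}
    (hs : s ∈ Icc (0 : ℝ) 1) (ht : t ∈ Icc (0 : ℝ) 1) (h : gridMap p a s = gridMap p b t) :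
    IsEnd s ∧ IsEnd t ∧ s ≠ t := by
  rcases lt_or_gt_of_ne hab with hlt | hlt
  · obtain ⟨rfl, rfl⟩ := gridMap_eq_of_lt hp hlt hs ht h
    simp [IsEnd]
  · obtain ⟨rfl, rfl⟩ := gridMap_eq_of_lt hp hlt ht hs h.symm
    simp [IsEnd]

theorem gridMap_eq_unique (hp : ∀ j, 0 < p j) {a b : Fin N} (hab : a ≠ b) {s t s' t' : ℝ}
    (hs : s ∈ Icc (0 : ℝ) 1) (ht : t ∈ Icc (0 : ℝ) 1) (h : gridMap p a s = gridMap p b t)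
    (hs' : s' ∈ Icc (0 : ℝ) 1) (ht' : t' ∈ Icc (0 : ℝ) 1)
    (h' : gridMap p a s' = gridMap p b t') : s' = s ∧ t' = t := by
  rcases lt_or_gt_of_ne hab with hlt | hlt
  · obtain ⟨rfl, rfl⟩ := gridMap_eq_of_lt hp hlt hs ht h
    exact gridMap_eq_of_lt hp hlt hs' ht' h'
  · obtain ⟨rfl, rfl⟩ := gridMap_eq_of_lt hp hlt ht hs h.symm
    exact (gridMap_eq_of_lt hp hlt ht' hs' h'.symm).symm

/-! ### Intervals of higher level -/

theorem segMap_injective (hp : ∀ j, 0 < p j) :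
    ∀ (n : ℕ) (w : Fin n → Fin N), Function.Injective (segMap p n w)
  | 0, _ => Function.injective_id
  | n + 1, w => (gridMap_injective hp (w 0)).comp (segMap_injective hp n (Fin.tail w))

theorem segMap_mem (hp : ∀ j, 0 < p j) (hs : ∑ j, p j = 1) :
    ∀ (n : ℕ) (w : Fin n → Fin N) {s : ℝ}, s ∈ Icc (0 : ℝ) 1 → segMap p n w s ∈ Icc (0 : ℝ) 1
  | 0, _, _, h => h
  | n + 1, w, _, h => gridMap_mem hp hs (w 0) (segMap_mem hp hs n (Fin.tail w) h)

theorem segMap_succ_last : ∀ (n : ℕ) (w : Fin (n + 1) → Fin N) (s : ℝ),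
    segMap p (n + 1) w s = segMap p n (Fin.init w) (gridMap p (w (Fin.last n)) s)
  | 0, _, _ => rfl
  | n + 1, w, s => by
    have h := segMap_succ_last n (Fin.tail w) s
    simp only [segMap, Function.comp_apply] at h ⊢
    rw [h, ← Fin.tail_init_eq_init_tail]
    rfl

theorem IsEnd.of_segMap (hp : ∀ j, 0 < p j) (hs : ∑ j, p j = 1) :
    ∀ (n : ℕ) (w : Fin n → Fin N) {s : ℝ}, s ∈ Icc (0 : ℝ) 1 → IsEnd (segMap p n w s) → IsEnd s
  | 0, _, _, _, he => he
  | n + 1, w, _, h, he => IsEnd.of_segMap hp hs n (Fin.tail w) h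
      (IsEnd.of_gridMap hp hs (segMap_mem hp hs n _ h) he)

/-- Where the words first differ, the remaining map already takes an endpoint value, and only
endpoints are mapped to endpoints. If they never differ, injectivity gives `s = t`. -/
theorem segMap_isEnd (hp : ∀ j, 0 < p j) (hs : ∑ j, p j = 1) :
    ∀ (n : ℕ) {u v : Fin n → Fin N} {s t : ℝ}, s ∈ Icc (0 : ℝ) 1 → t ∈ Icc (0 : ℝ) 1 →
      segMap p n u s = segMap p n v t → IsEnd t → IsEnd s
  | 0, _, _, s, t, _, _, h, he => by
    change s = t at h
    rwa [h]
  | n + 1, u, v, s, t, h1, h2, h, he => by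
    by_cases h0 : u 0 = v 0
    · refine segMap_isEnd hp hs n h1 h2 (gridMap_injective hp (u 0) ?_) he
        (u := Fin.tail u) (v := Fin.tail v)
      simp only [segMap, Function.comp_apply] at h
      rw [h, h0]
    · exact IsEnd.of_segMap hp hs n _ h1 (gridMap_eq_of_ne hp h0 (segMap_mem hp hs n _ h1)
        (segMap_mem hp hs n _ h2) h).1

/-- Distinct intervals of one level share at most one point, as seen at the first digit where the
words differ. -/
theorem segMap_eq_unique (hp : ∀ j, 0 < p j) (hs : ∑ j, p j = 1) :
    ∀ (n : ℕ) {u v : Fin n → Fin N} {s t s' t' : ℝ}, u ≠ v → s ∈ Icc (0 : ℝ) 1 →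
      t ∈ Icc (0 : ℝ) 1 → segMap p n u s = segMap p n v t → s' ∈ Icc (0 : ℝ) 1 →
      t' ∈ Icc (0 : ℝ) 1 → segMap p n u s' = segMap p n v t' → s' = s ∧ t' = t
  | 0, u, v, _, _, _, _, huv, _, _, _, _, _, _ => (huv (Subsingleton.elim u v)).elim
  | n + 1, u, v, s, t, s', t', huv, h1, h2, h, h1', h2', h' => by
    simp only [segMap, Function.comp_apply] at h h'
    by_cases h0 : u 0 = v 0
    · have ht : Fin.tail u ≠ Fin.tail v := fun e => huv (by
        rw [← Fin.cons_self_tail u, ← Fin.cons_self_tail v, e, h0])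
      rw [h0] at h h'
      exact segMap_eq_unique hp hs n ht h1 h2 (gridMap_injective hp _ h) h1' h2'
        (gridMap_injective hp _ h')
    · have := gridMap_eq_unique hp h0 (segMap_mem hp hs n _ h1) (segMap_mem hp hs n _ h2) h
        (segMap_mem hp hs n _ h1') (segMap_mem hp hs n _ h2') h'
      exact ⟨segMap_injective hp n _ this.1, segMap_injective hp n _ this.2⟩

/-- At a common endpoint, coincidences of points survive the refinement by one further digit. -/
theorem segMap_gridMap_eq (hp : ∀ j, 0 < p j) (hs : ∑ j, p j = 1) {n : ℕ}
    {u v : Fin n → Fin N} {c d : Fin N} {s t s' t' : ℝ} (h1 : s ∈ Icc (0 : ℝ) 1)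
    (h2 : t ∈ Icc (0 : ℝ) 1)
    (h : segMap p n u (gridMap p c s) = segMap p n v (gridMap p d t))
    (he : IsEnd (gridMap p c s)) (he' : IsEnd (gridMap p d t)) (h1' : s' ∈ Icc (0 : ℝ) 1)
    (h2' : t' ∈ Icc (0 : ℝ) 1) (h' : segMap p n u s' = segMap p n v t') :
    segMap p n u (gridMap p c s') = segMap p n v (gridMap p d t') := by
  by_cases huv : u = v
  · subst huv
    rw [digit_eq_of_isEnd hp hs h1 h2 (segMap_injective hp n u h) he,
      segMap_injective hp n u h']
  · obtain ⟨e1, e2⟩ := segMap_eq_unique hp hs n huv he.mem_Icc he'.mem_Icc h h1' h2' h'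
    rw [eq_of_gridMap_isEnd hp hs h1 he] at e1
    rw [eq_of_gridMap_isEnd hp hs h2 he'] at e2
    rw [e1, e2, h]

/-! Deleting the middle map from compositions `gridMap p a ∘ gridMap p b`. -/

/-- If the first digits differ or the second digits agree, then deleting the second digit does
not create coincidences. -/
theorem gridMap_insert (hp : ∀ j, 0 < p j) (hs : ∑ j, p j = 1) {a b a' b' : Fin N}
    {s s' t t' : ℝ} (h1 : s ∈ Icc (0 : ℝ) 1) (h1' : s' ∈ Icc (0 : ℝ) 1)
    (h : gridMap p a (gridMap p b s) = gridMap p a' (gridMap p b' s'))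
    (hc : a = a' → b = b') (h2 : t ∈ Icc (0 : ℝ) 1) (h2' : t' ∈ Icc (0 : ℝ) 1)
    (ht : gridMap p a t = gridMap p a' t') :
    gridMap p a (gridMap p b t) = gridMap p a' (gridMap p b' t') := by
  by_cases haa : a = a'
  · obtain rfl := haa
    rw [hc rfl, gridMap_injective hp _ ht]
  · have hm := gridMap_mem hp hs b h1
    have hm' := gridMap_mem hp hs b' h1'
    obtain ⟨e1, e2, -⟩ := gridMap_eq_of_ne hp haa hm hm' h
    obtain ⟨e3, e4⟩ := gridMap_eq_unique hp haa hm hm' h h2 h2' ht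
    rw [e3, e4, eq_of_gridMap_isEnd hp hs h1 e1, eq_of_gridMap_isEnd hp hs h1' e2] at *
    exact h

/-- For `a ≠ a'` both inner values are endpoints, hence fixed by the inner maps; for `a = a'`
everything cancels. -/
theorem gridMap_delete (hp : ∀ j, 0 < p j) (hs : ∑ j, p j = 1) {a b a' b' : Fin N}
    {s s' : ℝ} (h1 : s ∈ Icc (0 : ℝ) 1) (h1' : s' ∈ Icc (0 : ℝ) 1)
    (h : gridMap p a (gridMap p b s) = gridMap p a' (gridMap p b' s'))
    (hc : a = a' → b = b') : gridMap p a s = gridMap p a' s' := by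
  by_cases haa : a = a'
  · obtain rfl := haa
    rw [hc rfl] at h
    rw [gridMap_injective hp _ (gridMap_injective hp _ h)]
  · obtain ⟨e1, e2, -⟩ := gridMap_eq_of_ne hp haa (gridMap_mem hp hs b h1)
      (gridMap_mem hp hs b' h1') h
    rwa [eq_of_gridMap_isEnd hp hs h1 e1, eq_of_gridMap_isEnd hp hs h1' e2] at h

/-- At an endpoint of a first level interval, the first digit determines the second one. -/
theorem second_digit_eq (hp : ∀ j, 0 < p j) (hs : ∑ j, p j = 1) {a b a' b' c d : Fin N}
    {s s' t : ℝ} (h1 : s ∈ Icc (0 : ℝ) 1) (h1' : s' ∈ Icc (0 : ℝ) 1) (h2 : t ∈ Icc (0 : ℝ) 1)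
    (h : gridMap p a (gridMap p b s) = gridMap p c (gridMap p d t))
    (h' : gridMap p a' (gridMap p b' s') = gridMap p c (gridMap p d t)) (hac : a ≠ c)
    (haa : a = a') : b = b' := by
  subst haa
  have hm := gridMap_mem hp hs b h1
  exact digit_eq_of_isEnd hp hs h1 h1' (gridMap_injective hp a (h.trans h'.symm))
    (gridMap_eq_of_ne hp hac hm (gridMap_mem hp hs d h2) h).1

/-- At a common endpoint of two first level intervals, a point of a shortened word is obtained
from a point of one of the two given words. -/
theorem gridMap_insert_of_ne (hp : ∀ j, 0 < p j) (hs : ∑ j, p j = 1) {a b a' b' c : Fin N}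
    {s s' t : ℝ} (h1 : s ∈ Icc (0 : ℝ) 1) (h1' : s' ∈ Icc (0 : ℝ) 1)
    (h : gridMap p a (gridMap p b s) = gridMap p a' (gridMap p b' s')) (hne : a ≠ a')
    (h2 : t ∈ Icc (0 : ℝ) 1) (ht : gridMap p c t = gridMap p a s) :
    gridMap p c (gridMap p b t) = gridMap p a (gridMap p b s) ∨
      gridMap p c (gridMap p b' t) = gridMap p a (gridMap p b s) := by
  obtain ⟨e1, e2, e3⟩ := gridMap_eq_of_ne hp hne (gridMap_mem hp hs b h1)
    (gridMap_mem hp hs b' h1') h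
  have f1 := eq_of_gridMap_isEnd hp hs h1 e1
  have f2 := eq_of_gridMap_isEnd hp hs h1' e2
  by_cases hca : c = a
  · subst hca
    left
    rw [gridMap_injective hp _ ht]
  · right
    rw [f1, f2] at e3
    rw [f1] at e1 h
    rw [f2] at e2 h
    obtain ⟨g1, -, g3⟩ := gridMap_eq_of_ne hp hca h2 h1 ht
    have : t = s' := by
      rcases e1 with rfl | rfl <;> rcases e2 with rfl | rfl <;> rcases g1 with rfl | rfl <;>
        simp_all
    rw [this, f2, ← this, ht, f1]

/-- A point which is interior to a second level interval determines its first two digits. -/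
theorem digits_eq_of_not_isEnd (hp : ∀ j, 0 < p j) (hs : ∑ j, p j = 1) {a b a' b' : Fin N}
    {s s' : ℝ} (h1 : s ∈ Icc (0 : ℝ) 1) (h1' : s' ∈ Icc (0 : ℝ) 1)
    (h : gridMap p a (gridMap p b s) = gridMap p a' (gridMap p b' s')) (he : ¬ IsEnd s) :
    a = a' ∧ b = b' := by
  have haa : a = a' := by
    by_contra hne
    exact he (IsEnd.of_gridMap hp hs h1 (gridMap_eq_of_ne hp hne (gridMap_mem hp hs b h1)
      (gridMap_mem hp hs b' h1') h).1)
  subst haa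
  refine ⟨rfl, ?_⟩
  by_contra hne
  exact he (gridMap_eq_of_ne hp hne h1 h1' (gridMap_injective hp _ h)).1

theorem gridMap_insert_of_not_isEnd (hp : ∀ j, 0 < p j) {a b c : Fin N} {s t : ℝ}
    (h1 : s ∈ Icc (0 : ℝ) 1) (h2 : t ∈ Icc (0 : ℝ) 1) (he : ¬ IsEnd s)
    (ht : gridMap p c t = gridMap p a s) :
    gridMap p c (gridMap p b t) = gridMap p a (gridMap p b s) := by
  have hca : c = a := by
    by_contra hne
    exact he (gridMap_eq_of_ne hp hne h2 h1 ht).2.1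
  subst hca
  rw [gridMap_injective hp _ ht]

/-- If the image under a word of positive length is an endpoint, so is the image of the point under
the last digit. -/
theorem isEnd_gridMap_last (hp : ∀ j, 0 < p j) (hs : ∑ j, p j = 1) {n : ℕ}
    {w : Fin (n + 1) → Fin N} {s : ℝ} (h : s ∈ Icc (0 : ℝ) 1)
    (he : IsEnd (segMap p (n + 1) w s)) : IsEnd (gridMap p (w (Fin.last n)) s) := by
  rw [segMap_succ_last] at he
  exact IsEnd.of_segMap hp hs n _ (gridMap_mem hp hs _ h) he

end Interval

end BaranskiData

namespace BaranskiData

variable (B : BaranskiData)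

/-! ### Cells in coordinates -/

/-- The column digits of a word. -/
def colWord {B : BaranskiData} {n : ℕ} (w : B.Word n) : Fin n → Fin B.N := fun i => (w i).1.1

/-- The row digits of a word. -/
def rowWord {B : BaranskiData} {n : ℕ} (w : B.Word n) : Fin n → Fin B.M := fun i => (w i).1.2

theorem wordMap_eq : ∀ (n : ℕ) (w : B.Word n) (x : ℝ × ℝ),
    B.wordMap n w x = (segMap B.p n (colWord w) x.1, segMap B.r n (rowWord w) x.2)
  | 0, _, _ => rfl
  | n + 1, w, x => by
    simp only [wordMap, Function.comp_apply, wordMap_eq n]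
    rfl

theorem continuous_wordMap : ∀ (n : ℕ) (w : B.Word n), Continuous (B.wordMap n w)
  | 0, _ => continuous_id
  | n + 1, w => (B.continuous_digitMap (w 0)).comp (continuous_wordMap n (Fin.tail w))

theorem wordMap_injective : ∀ (n : ℕ) (w : B.Word n), Function.Injective (B.wordMap n w)
  | 0, _ => Function.injective_id
  | n + 1, w => (B.digitMap_injective (w 0)).comp (wordMap_injective n (Fin.tail w))

theorem carpet_mem_Icc {k : ℝ × ℝ} (hk : k ∈ B.carpet) :
    k.1 ∈ Icc (0 : ℝ) 1 ∧ k.2 ∈ Icc (0 : ℝ) 1 :=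
  mem_iInter.1 hk 0

theorem digitMap_mem_carpet (c : B.D) {k : ℝ × ℝ} (hk : k ∈ B.carpet) :
    B.digitMap c k ∈ B.carpet := by
  rw [carpet_eq_iUnion]
  exact mem_iUnion.2 ⟨c, k, hk, rfl⟩

theorem exists_digitMap_eq {k : ℝ × ℝ} (hk : k ∈ B.carpet) :
    ∃ c : B.D, ∃ l ∈ B.carpet, B.digitMap c l = k := by
  rw [carpet_eq_iUnion] at hk
  exact mem_iUnion.1 hk

theorem wordMap_succ_last : ∀ (n : ℕ) (w : B.Word (n + 1)) (x : ℝ × ℝ),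
    B.wordMap (n + 1) w x = B.wordMap n (Fin.init w) (B.digitMap (w (Fin.last n)) x)
  | 0, _, _ => rfl
  | n + 1, w, x => by
    have h := wordMap_succ_last n (Fin.tail w) x
    simp only [wordMap, Function.comp_apply] at h ⊢
    rw [h, ← Fin.tail_init_eq_init_tail]
    rfl

theorem iUnion_cell : ∀ n : ℕ, ⋃ w : B.Word n, B.cell w = B.carpet
  | 0 => by
    have : Nonempty (B.Word 0) := ⟨Fin.elim0⟩
    simp only [cell, wordMap, image_id, iUnion_const]
  | n + 1 => by
    apply Subset.antisymm
    · refine iUnion_subset fun w => ?_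
      rintro _ ⟨k, hk, rfl⟩
      refine B.digitMap_mem_carpet (w 0) ?_
      rw [← iUnion_cell n]
      exact mem_iUnion.2 ⟨Fin.tail w, k, hk, rfl⟩
    · intro x hx
      obtain ⟨c, l, hl, rfl⟩ := B.exists_digitMap_eq hx
      rw [← iUnion_cell n] at hl
      obtain ⟨w, k, hk, rfl⟩ := mem_iUnion.1 hl
      exact mem_iUnion.2 ⟨Fin.cons c w, k, hk, by simp [wordMap]⟩

theorem isCompact_cell {n : ℕ} (w : B.Word n) : IsCompact (B.cell w) :=
  B.isCompact_carpet.image (B.continuous_wordMap n w)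

/-- If `K` were a point, two distinct digit maps would agree there; but different intervals share a
point only as images of different endpoints. -/
theorem exists_mem_carpet_ne (x : ℝ × ℝ) : ∃ k ∈ B.carpet, k ≠ x := by
  by_contra! h
  obtain ⟨k, hk⟩ := B.carpet_nonempty
  obtain ⟨a, b, hab⟩ := Fintype.one_lt_card_iff.1
    (by simpa using B.one_lt_card : 1 < Fintype.card B.D)
  have ha := (h _ (B.digitMap_mem_carpet a hk)).trans (h k hk).symm
  have hb := (h _ (B.digitMap_mem_carpet b hk)).trans (h k hk).symm
  obtain ⟨h1, h2⟩ := B.carpet_mem_Icc hk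
  have hc1 : gridMap B.p a.1.1 k.1 = gridMap B.p b.1.1 k.1 := congrArg Prod.fst (ha.trans hb.symm)
  have hc2 : gridMap B.r a.1.2 k.2 = gridMap B.r b.1.2 k.2 := congrArg Prod.snd (ha.trans hb.symm)
  apply hab
  refine Subtype.ext (Prod.ext ?_ ?_)
  · by_contra hne
    exact (gridMap_eq_of_ne B.p_pos hne h1 h1 hc1).2.2 rfl
  · by_contra hne
    exact (gridMap_eq_of_ne B.r_pos hne h2 h2 hc2).2.2 rfl

theorem exists_mem_cell_ne {n : ℕ} (w : B.Word n) (x : ℝ × ℝ) : ∃ y ∈ B.cell w, y ≠ x := by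
  by_cases hx : x ∈ B.cell w
  · obtain ⟨k, hk, rfl⟩ := hx
    obtain ⟨l, hl, hlk⟩ := B.exists_mem_carpet_ne k
    exact ⟨_, ⟨l, hl, rfl⟩, (B.wordMap_injective n w).ne hlk⟩
  · obtain ⟨k, hk⟩ := B.carpet_nonempty
    exact ⟨_, ⟨k, hk, rfl⟩, fun h => hx ⟨k, hk, h⟩⟩

/-! ### Splitting the cells at a point -/

/-- The level-`n` cells containing `x` fall into two nonempty classes such that cells of
different classes meet only at `x`. -/
def Splits (n : ℕ) (x : ℝ × ℝ) : Prop :=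
  ∃ I : Set (B.Word n), (∃ w ∈ I, x ∈ B.cell w) ∧ (∃ w ∉ I, x ∈ B.cell w) ∧
    ∀ w ∈ I, ∀ v ∉ I, x ∈ B.cell w → x ∈ B.cell v → B.cell w ∩ B.cell v ⊆ {x}

variable {B}

/-- A map between the words at `x` and the words at `x'` which creates no new intersections
transports splittings. -/
theorem Splits.map {n m : ℕ} {x x' : ℝ × ℝ} (h : B.Splits n x) (G : B.Word n → B.Word m)
    (h1 : ∀ w, x ∈ B.cell w → x' ∈ B.cell (G w))
    (h2 : ∀ u, x' ∈ B.cell u → ∃ w, x ∈ B.cell w ∧ G w = u)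
    (h3 : ∀ w v, x ∈ B.cell w → x ∈ B.cell v → B.cell w ∩ B.cell v ⊆ {x} →
      B.cell (G w) ∩ B.cell (G v) ⊆ {x'}) : B.Splits m x' := by
  obtain ⟨I, ⟨w, hwI, hw⟩, ⟨v, hvI, hv⟩, hI⟩ := h
  refine ⟨{u | ∃ w ∈ I, x ∈ B.cell w ∧ G w = u}, ⟨G w, ⟨w, hwI, hw, rfl⟩, h1 w hw⟩,
    ⟨G v, ?_, h1 v hv⟩, ?_⟩
  -- If words from both classes had the same image, its cell would meet itself only at `x'`, yet no
  -- cell is a single point.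
  · rintro ⟨w, hwI, hw, hwv⟩
    obtain ⟨y, hy, hyx⟩ := B.exists_mem_cell_ne (G v) x'
    exact hyx (h3 w v hw hv (hI w hwI v hvI hw hv) ⟨hwv ▸ hy, hy⟩)
  · rintro _ ⟨w, hwI, hw, rfl⟩ u hu - hux
    obtain ⟨v, hv, rfl⟩ := h2 u hux
    exact h3 w v hw hv (hI w hwI v (fun hvI => hu ⟨v, hvI, hv, rfl⟩) hw hv)

/-- If all words at a point share the first digit, that digit can be deleted. -/
theorem Splits.tail {n : ℕ} {x : ℝ × ℝ} (h : B.Splits (n + 1) x) {a : B.D}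
    (ha : ∀ w : B.Word (n + 1), x ∈ B.cell w → w 0 = a) : ∃ x', B.Splits n x' := by
  obtain ⟨-, ⟨w0, -, hw0⟩, -⟩ := id h
  obtain ⟨k, hk, hkx⟩ := id hw0
  have hx : ∀ w : B.Word (n + 1), w 0 = a → (x ∈ B.cell w ↔
      B.wordMap n (Fin.tail w0) k ∈ B.cell (Fin.tail w)) := by
    intro w hw
    constructor
    · rintro ⟨l, hl, hlx⟩
      refine ⟨l, hl, B.digitMap_injective a ?_⟩
      rw [← hkx] at hlx
      simpa [wordMap, hw, ha w0 hw0] using hlx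
    · rintro ⟨l, hl, hlx⟩
      refine ⟨l, hl, ?_⟩
      rw [← hkx]
      simp [wordMap, hw, ha w0 hw0, hlx]
  refine ⟨B.wordMap n (Fin.tail w0) k, h.map Fin.tail (fun w hw => (hx w (ha w hw)).1 hw)
    (fun u hu => ⟨Fin.cons a u, (hx _ (by simp)).2 (by simpa using hu), by simp⟩) ?_⟩
  rintro w v hw hv hwv y ⟨⟨l, hl, hly⟩, ⟨l', hl', hly'⟩⟩
  have := hwv (show B.digitMap a y ∈ _ from
    ⟨⟨l, hl, by simp [wordMap, ha w hw, hly]⟩, ⟨l', hl', by simp [wordMap, ha v hv, hly']⟩⟩)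
  rw [mem_singleton_iff, ← hkx] at this
  exact B.digitMap_injective a (by simpa [wordMap, ha w0 hw0] using this)

/-- At a common corner of all level-`n` cells containing it, the last digit can be deleted. -/
theorem Splits.init {n : ℕ} {x : ℝ × ℝ} (h : B.Splits (n + 1) x)
    (hx : ∀ (u : B.Word n), ∀ k ∈ B.carpet, B.wordMap n u k = x → IsEnd k.1 ∧ IsEnd k.2) :
    B.Splits n x := by
  refine h.map Fin.init ?_ ?_ ?_
  · rintro w ⟨k, hk, rfl⟩
    rw [wordMap_succ_last]
    exact ⟨_, B.digitMap_mem_carpet _ hk, rfl⟩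
  · rintro u ⟨k, hk, rfl⟩
    obtain ⟨c, l, hl, rfl⟩ := B.exists_digitMap_eq hk
    exact ⟨Fin.snoc u c, ⟨l, hl, by simp [wordMap_succ_last]⟩, by simp⟩
  · rintro w v ⟨k, hk, hkx⟩ ⟨l, hl, hlx⟩ hwv y ⟨⟨k', hk', hky⟩, ⟨l', hl', hly⟩⟩
    rw [wordMap_succ_last] at hkx hlx
    have ek := hx _ _ (B.digitMap_mem_carpet _ hk) hkx
    have el := hx _ _ (B.digitMap_mem_carpet _ hl) hlx
    have mk := B.carpet_mem_Icc hk
    have ml := B.carpet_mem_Icc hl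
    have mk' := B.carpet_mem_Icc hk'
    have ml' := B.carpet_mem_Icc hl'
    have hkl := hkx.trans hlx.symm
    have hkl' := hky.trans hly.symm
    rw [wordMap_eq, wordMap_eq, Prod.mk.injEq] at hkl hkl'
    have hz : B.wordMap (n + 1) w k' = B.wordMap (n + 1) v l' := by
      rw [wordMap_succ_last, wordMap_succ_last, wordMap_eq, wordMap_eq]
      exact Prod.ext
        (segMap_gridMap_eq B.p_pos B.p_sum mk.1 ml.1 hkl.1 ek.1 el.1 mk'.1 ml'.1 hkl'.1)
        (segMap_gridMap_eq B.r_pos B.r_sum mk.2 ml.2 hkl.2 ek.2 el.2 mk'.2 ml'.2 hkl'.2)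
    have hzx := hwv ⟨⟨k', hk', rfl⟩, ⟨l', hl', hz.symm⟩⟩
    rw [mem_singleton_iff, ← hkx, wordMap_succ_last] at hzx
    have hkk := B.digitMap_injective _ (B.wordMap_injective _ _ hzx)
    -- A point sent to a corner of the unit square is that corner, so deleting the last digit does
    -- not move `x`.
    have hfix : B.digitMap (w (Fin.last n)) k = k :=
      Prod.ext (eq_of_gridMap_isEnd B.p_pos B.p_sum mk.1 ek.1)
        (eq_of_gridMap_isEnd B.r_pos B.r_sum mk.2 ek.2)
    rw [mem_singleton_iff, ← hky, ← hkx, hfix, hkk]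

/-! ### Deleting the second digit -/

/-- The word obtained by deleting the second digit. -/
def deleteSecond {n : ℕ} (w : B.Word (n + 2)) : B.Word (n + 1) :=
  Fin.cons (w 0) (Fin.tail (Fin.tail w))

/-- The image of the point `k` under the word without its first two digits. -/
def tailPoint {n : ℕ} (w : B.Word (n + 2)) (k : ℝ × ℝ) : ℝ × ℝ :=
  B.wordMap n (Fin.tail (Fin.tail w)) k

theorem tailPoint_mem_Icc {n : ℕ} (w : B.Word (n + 2)) {k : ℝ × ℝ} (hk : k ∈ B.carpet) :
    (tailPoint w k).1 ∈ Icc (0 : ℝ) 1 ∧ (tailPoint w k).2 ∈ Icc (0 : ℝ) 1 := by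
  have h : tailPoint w k ∈ ⋃ w : B.Word n, B.cell w := mem_iUnion.2 ⟨_, k, hk, rfl⟩
  rw [iUnion_cell] at h
  exact B.carpet_mem_Icc h

theorem wordMap_add_two {n : ℕ} (w : B.Word (n + 2)) (k : ℝ × ℝ) :
    B.wordMap (n + 2) w k =
      (gridMap B.p (w 0).1.1 (gridMap B.p (w 1).1.1 (tailPoint w k).1),
       gridMap B.r (w 0).1.2 (gridMap B.r (w 1).1.2 (tailPoint w k).2)) := rfl

theorem wordMap_deleteSecond {n : ℕ} (w : B.Word (n + 2)) (k : ℝ × ℝ) :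
    B.wordMap (n + 1) (deleteSecond w) k =
      (gridMap B.p (w 0).1.1 (tailPoint w k).1, gridMap B.r (w 0).1.2 (tailPoint w k).2) := rfl

/-- Deleting the second digit, provided that the first digits of the words at the point determine
the second ones, coordinate by coordinate, and that no new words arise. -/
theorem Splits.deleteSecond {n : ℕ} {x : ℝ × ℝ} (h : B.Splits (n + 2) x)
    (hc1 : ∀ w v : B.Word (n + 2), x ∈ B.cell w → x ∈ B.cell v →
      (w 0).1.1 = (v 0).1.1 → (w 1).1.1 = (v 1).1.1)
    (hc2 : ∀ w v : B.Word (n + 2), x ∈ B.cell w → x ∈ B.cell v →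
      (w 0).1.2 = (v 0).1.2 → (w 1).1.2 = (v 1).1.2)
    {w0 : B.Word (n + 2)} {k0 : ℝ × ℝ} (hk0 : k0 ∈ B.carpet) (hx : B.wordMap (n + 2) w0 k0 = x)
    (hn : ∀ (d : B.D) (t : ℝ × ℝ), t.1 ∈ Icc (0 : ℝ) 1 → t.2 ∈ Icc (0 : ℝ) 1 →
      gridMap B.p d.1.1 t.1 = gridMap B.p (w0 0).1.1 (tailPoint w0 k0).1 →
      gridMap B.r d.1.2 t.2 = gridMap B.r (w0 0).1.2 (tailPoint w0 k0).2 →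
      ∃ c : B.D, gridMap B.p d.1.1 (gridMap B.p c.1.1 t.1) = x.1 ∧
        gridMap B.r d.1.2 (gridMap B.r c.1.2 t.2) = x.2) :
    B.Splits (n + 1) (B.wordMap (n + 1) (BaranskiData.deleteSecond w0) k0) := by
  -- The shortened words all pass through one point, in general different from `x`.
  have key : ∀ w : B.Word (n + 2), ∀ k ∈ B.carpet, B.wordMap (n + 2) w k = x →
      B.wordMap (n + 1) (BaranskiData.deleteSecond w) k =
        B.wordMap (n + 1) (BaranskiData.deleteSecond w0) k0 := by
    intro w k hk hkx
    have m := tailPoint_mem_Icc w hk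
    have m0 := tailPoint_mem_Icc w0 hk0
    have e := hkx.trans hx.symm
    rw [wordMap_add_two, wordMap_add_two, Prod.mk.injEq] at e
    rw [wordMap_deleteSecond, wordMap_deleteSecond]
    exact Prod.ext
      (gridMap_delete B.p_pos B.p_sum m.1 m0.1 e.1 (hc1 w w0 ⟨k, hk, hkx⟩ ⟨k0, hk0, hx⟩))
      (gridMap_delete B.r_pos B.r_sum m.2 m0.2 e.2 (hc2 w w0 ⟨k, hk, hkx⟩ ⟨k0, hk0, hx⟩))
  refine h.map BaranskiData.deleteSecond ?_ ?_ ?_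
  · rintro w ⟨k, hk, hkx⟩
    exact ⟨k, hk, key w k hk hkx⟩
  · rintro u ⟨k, hk, hkx⟩
    have mt : B.wordMap n (Fin.tail u) k ∈ ⋃ w : B.Word n, B.cell w :=
      mem_iUnion.2 ⟨_, k, hk, rfl⟩
    rw [iUnion_cell] at mt
    have mt := B.carpet_mem_Icc mt
    rw [wordMap_deleteSecond, Prod.ext_iff] at hkx
    obtain ⟨c, hc, hc'⟩ := hn (u 0) _ mt.1 mt.2 hkx.1 hkx.2
    refine ⟨Fin.cons (u 0) (Fin.cons c (Fin.tail u)), ⟨k, hk, Prod.ext hc hc'⟩, ?_⟩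
    simp [BaranskiData.deleteSecond]
  · rintro w v ⟨k, hk, hkx⟩ ⟨l, hl, hlx⟩ hwv y ⟨⟨k', hk', hky⟩, ⟨l', hl', hly⟩⟩
    have mk := tailPoint_mem_Icc w hk
    have ml := tailPoint_mem_Icc v hl
    have mk' := tailPoint_mem_Icc w hk'
    have ml' := tailPoint_mem_Icc v hl'
    have hkl := hkx.trans hlx.symm
    have hkl' := hky.trans hly.symm
    rw [wordMap_add_two, wordMap_add_two, Prod.mk.injEq] at hkl
    rw [wordMap_deleteSecond, wordMap_deleteSecond, Prod.mk.injEq] at hkl'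
    have hz : B.wordMap (n + 2) w k' = B.wordMap (n + 2) v l' := by
      rw [wordMap_add_two, wordMap_add_two]
      exact Prod.ext
        (gridMap_insert B.p_pos B.p_sum mk.1 ml.1 hkl.1
          (hc1 w v ⟨k, hk, hkx⟩ ⟨l, hl, hlx⟩) mk'.1 ml'.1 hkl'.1)
        (gridMap_insert B.r_pos B.r_sum mk.2 ml.2 hkl.2
          (hc2 w v ⟨k, hk, hkx⟩ ⟨l, hl, hlx⟩) mk'.2 ml'.2 hkl'.2)
    have hzx := hwv ⟨⟨k', hk', rfl⟩, ⟨l', hl', hz.symm⟩⟩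
    rw [mem_singleton_iff, ← hkx] at hzx
    rw [mem_singleton_iff, ← hky, B.wordMap_injective _ _ hzx, key w k hk hkx]

end BaranskiData

/-! ### Descent to level two -/

namespace BaranskiData

/-- Length at least three matters: the tail beyond the second digit is nonempty, so its last digit
already maps `s` to an endpoint, and the point is an endpoint one level up. -/
theorem isEnd_of_tail_isEnd {N : ℕ} {p : Fin N → ℝ} (hp : ∀ j, 0 < p j) (hs : ∑ j, p j = 1)
    {n : ℕ} {w : Fin (n + 3) → Fin N} {s : ℝ} (h : s ∈ Icc (0 : ℝ) 1)
    (he : IsEnd (segMap p (n + 1) (Fin.tail (Fin.tail w)) s)) (u : Fin (n + 2) → Fin N) {t : ℝ}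
    (ht : t ∈ Icc (0 : ℝ) 1) (hu : segMap p (n + 2) u t = segMap p (n + 3) w s) : IsEnd t := by
  have he := isEnd_gridMap_last hp hs h he
  rw [segMap_succ_last (n + 2)] at hu
  exact segMap_isEnd hp hs _ ht (gridMap_mem hp hs _ h) hu he

variable {B : BaranskiData}

theorem Splits.init_of_isEnd {n : ℕ} {x : ℝ × ℝ} (h : B.Splits (n + 3) x)
    {w v : B.Word (n + 3)} {k l : ℝ × ℝ} (hk : k ∈ B.carpet) (hl : l ∈ B.carpet)
    (hkx : B.wordMap (n + 3) w k = x) (hlx : B.wordMap (n + 3) v l = x)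
    (he : IsEnd (tailPoint w k).1) (he' : IsEnd (tailPoint v l).2) : B.Splits (n + 2) x := by
  refine h.init fun u t ht htx => ?_
  have mt := B.carpet_mem_Icc ht
  have e := htx.trans hkx.symm
  have e' := htx.trans hlx.symm
  rw [tailPoint, wordMap_eq] at he he'
  rw [wordMap_eq, wordMap_eq, Prod.mk.injEq] at e e'
  exact ⟨isEnd_of_tail_isEnd B.p_pos B.p_sum (B.carpet_mem_Icc hk).1 he _ mt.1 e.1,
    isEnd_of_tail_isEnd B.r_pos B.r_sum (B.carpet_mem_Icc hl).2 he' _ mt.2 e'.2⟩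

/-- A splitting at a level at least three yields one at the preceding level. -/
theorem Splits.descend {n : ℕ} {x : ℝ × ℝ} (h : B.Splits (n + 3) x) :
    ∃ x', B.Splits (n + 2) x' := by
  obtain ⟨-, ⟨w0, -, hw0⟩, -⟩ := id h
  by_cases ha : ∀ w : B.Word (n + 3), x ∈ B.cell w → w 0 = w0 0
  · exact h.tail ha
  push Not at ha
  obtain ⟨v0, hv0, hne⟩ := ha
  obtain ⟨k0, hk0, hx⟩ := id hw0
  obtain ⟨l0, hl0, hx'⟩ := id hv0
  have mk := tailPoint_mem_Icc w0 hk0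
  have ml := tailPoint_mem_Icc v0 hl0
  have e := hx.trans hx'.symm
  rw [wordMap_add_two, wordMap_add_two, Prod.mk.injEq] at e
  have hxc := hx
  rw [wordMap_add_two, Prod.ext_iff] at hxc
  by_cases h1 : (w0 0).1.1 = (v0 0).1.1
  · have h2 : (w0 0).1.2 ≠ (v0 0).1.2 := fun h2 => hne (Subtype.ext (Prod.ext h1.symm h2.symm))
    have he2 := IsEnd.of_gridMap B.r_pos B.r_sum mk.2 (gridMap_eq_of_ne B.r_pos h2
      (gridMap_mem B.r_pos B.r_sum _ mk.2) (gridMap_mem B.r_pos B.r_sum _ ml.2) e.2).1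
    by_cases he : IsEnd (tailPoint w0 k0).1
    · exact ⟨x, h.init_of_isEnd hk0 hk0 hx hx he he2⟩
    have hd : ∀ w : B.Word (n + 3), x ∈ B.cell w →
        (w0 0).1.1 = (w 0).1.1 ∧ (w0 1).1.1 = (w 1).1.1 := by
      rintro w ⟨k, hk, hkx⟩
      have e := hx.trans hkx.symm
      rw [wordMap_add_two, wordMap_add_two, Prod.mk.injEq] at e
      exact digits_eq_of_not_isEnd B.p_pos B.p_sum mk.1 (tailPoint_mem_Icc w hk).1 e.1 he
    refine ⟨_, h.deleteSecond (fun w v hw hv _ => (hd w hw).2.symm.trans (hd v hv).2) ?_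
      hk0 hx ?_⟩
    · rintro w v ⟨k, hk, hkx⟩ ⟨l, hl, hlx⟩ hwv
      rw [wordMap_add_two, Prod.ext_iff] at hkx hlx hx hx'
      have mw := (tailPoint_mem_Icc w hk).2
      have mv := (tailPoint_mem_Icc v hl).2
      -- `second_digit_eq` needs a word at `x` with another first row; `w0` or `v0` always serves.
      by_cases hww : (w 0).1.2 = (w0 0).1.2
      · exact second_digit_eq B.r_pos B.r_sum mw mv ml.2 (hkx.2.trans hx'.2.symm)
          (hlx.2.trans hx'.2.symm) (hww ▸ h2) hwv
      · exact second_digit_eq B.r_pos B.r_sum mw mv mk.2 (hkx.2.trans hx.2.symm)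
          (hlx.2.trans hx.2.symm) hww hwv
    · intro d t ht1 ht2 hd1 hd2
      have g1 := gridMap_insert_of_not_isEnd (b := (w0 1).1.1) B.p_pos mk.1 ht1 he hd1
      -- The inserted digit must lie in `D`. The second digits of `w0` and `v0` do, have the same
      -- column, and one of them has the right row.
      rcases gridMap_insert_of_ne B.r_pos B.r_sum mk.2 ml.2 e.2 h2 ht2 hd2 with g2 | g2
      · exact ⟨w0 1, g1.trans hxc.1, g2.trans hxc.2⟩
      · exact ⟨v0 1, (hd v0 hv0).2 ▸ g1.trans hxc.1, g2.trans hxc.2⟩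
  -- The same argument with columns and rows exchanged.
  · have he1 := IsEnd.of_gridMap B.p_pos B.p_sum mk.1 (gridMap_eq_of_ne B.p_pos h1
      (gridMap_mem B.p_pos B.p_sum _ mk.1) (gridMap_mem B.p_pos B.p_sum _ ml.1) e.1).1
    by_cases he : IsEnd (tailPoint w0 k0).2
    · exact ⟨x, h.init_of_isEnd hk0 hk0 hx hx he1 he⟩
    have hd : ∀ w : B.Word (n + 3), x ∈ B.cell w →
        (w0 0).1.2 = (w 0).1.2 ∧ (w0 1).1.2 = (w 1).1.2 := by
      rintro w ⟨k, hk, hkx⟩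
      have e := hx.trans hkx.symm
      rw [wordMap_add_two, wordMap_add_two, Prod.mk.injEq] at e
      exact digits_eq_of_not_isEnd B.r_pos B.r_sum mk.2 (tailPoint_mem_Icc w hk).2 e.2 he
    refine ⟨_, h.deleteSecond ?_ (fun w v hw hv _ => (hd w hw).2.symm.trans (hd v hv).2)
      hk0 hx ?_⟩
    · rintro w v ⟨k, hk, hkx⟩ ⟨l, hl, hlx⟩ hwv
      rw [wordMap_add_two, Prod.ext_iff] at hkx hlx hx hx'
      have mw := (tailPoint_mem_Icc w hk).1
      have mv := (tailPoint_mem_Icc v hl).1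
      by_cases hww : (w 0).1.1 = (w0 0).1.1
      · exact second_digit_eq B.p_pos B.p_sum mw mv ml.1 (hkx.1.trans hx'.1.symm)
          (hlx.1.trans hx'.1.symm) (hww ▸ h1) hwv
      · exact second_digit_eq B.p_pos B.p_sum mw mv mk.1 (hkx.1.trans hx.1.symm)
          (hlx.1.trans hx.1.symm) hww hwv
    · intro d t ht1 ht2 hd1 hd2
      have g2 := gridMap_insert_of_not_isEnd (b := (w0 1).1.2) B.r_pos mk.2 ht2 he hd2
      rcases gridMap_insert_of_ne B.p_pos B.p_sum mk.1 ml.1 e.1 h1 ht1 hd1 with g1 | g1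
      · exact ⟨w0 1, g1.trans hxc.1, g2.trans hxc.2⟩
      · exact ⟨v0 1, g1.trans hxc.1, (hd v0 hv0).2 ▸ g2.trans hxc.2⟩

theorem Splits.exists_level_two {n : ℕ} {x : ℝ × ℝ} (h : B.Splits (n + 2) x) :
    ∃ x', B.Splits 2 x' := by
  induction n generalizing x with
  | zero => exact ⟨x, h⟩
  | succ n ih =>
    obtain ⟨x', h'⟩ := h.descend
    exact ih h'

/-! ### Local cut points -/

theorem exists_wordMap_dist_le (B : BaranskiData) : ∃ c < 1, 0 ≤ c ∧ ∀ (n : ℕ) (w : B.Word n) x y,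
    dist (B.wordMap n w x) (B.wordMap n w y) ≤ c ^ n * dist x y := by
  choose c hc1 hc0 hc using B.exists_dist_le
  have := B.nonempty_D
  obtain ⟨a, ha⟩ := Finite.exists_max c
  refine ⟨c a, hc1 a, hc0 a, fun n => ?_⟩
  induction n with
  | zero => simp [wordMap]
  | succ n ih =>
    intro w x y
    calc _ ≤ c (w 0) * dist (B.wordMap n (Fin.tail w) x) (B.wordMap n (Fin.tail w) y) := hc _ _ _
      _ ≤ c a * (c a ^ n * dist x y) :=
        mul_le_mul (ha _) (ih _ _ _) dist_nonneg (hc0 a)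
      _ = _ := by ring

theorem exists_level_cell_subset (B : BaranskiData) {ε : ℝ} (hε : 0 < ε) :
    ∃ n, ∀ (w : B.Word (n + 2)) (x : ℝ × ℝ), x ∈ B.cell w → B.cell w ⊆ Metric.ball x ε := by
  obtain ⟨c, hc1, hc0, hc⟩ := B.exists_wordMap_dist_le
  obtain ⟨n, hn⟩ := exists_pow_lt_of_lt_one hε hc1
  refine ⟨n, ?_⟩
  rintro w _ ⟨k, hk, rfl⟩ _ ⟨l, hl, rfl⟩
  have hd : dist l k ≤ 1 := by
    obtain ⟨h1, h2⟩ := B.carpet_mem_Icc hk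
    obtain ⟨h3, h4⟩ := B.carpet_mem_Icc hl
    rw [Prod.dist_eq]
    simpa using And.intro (Real.dist_le_of_mem_Icc h3 h1) (Real.dist_le_of_mem_Icc h4 h2)
  calc _ ≤ c ^ (n + 2) * dist l k := hc _ _ _ _
    _ ≤ c ^ (n + 2) * 1 := mul_le_mul_of_nonneg_left hd (pow_nonneg hc0 _)
    _ ≤ c ^ n := by
      rw [mul_one]
      exact pow_le_pow_of_le_one hc0 hc1.le (by omega)
    _ < ε := hn

/-- A cell without `x` is an injective affine image of `K` without a point; the absence of cut
points enters here. -/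
theorem isPreconnected_cell_diff (hconn : IsConnected B.carpet)
    (hcut : ¬ ∃ x, IsCutPoint B.carpet x) {n : ℕ} {w : B.Word n} {x : ℝ × ℝ}
    (hx : x ∈ B.cell w) : IsPreconnected (B.cell w \ {x}) := by
  obtain ⟨k, hk, rfl⟩ := hx
  have h : IsPreconnected (B.carpet \ {k}) := by
    by_contra h
    exact hcut ⟨k, hconn, hk, h⟩
  rw [cell, ← image_singleton, ← image_sdiff (B.wordMap_injective n w)]
  exact h.image _ (B.continuous_wordMap n w).continuousOn

/-- The cells containing `x` form a neighbourhood of `x` in the carpet. -/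
theorem exists_isOpen_cells (B : BaranskiData) (n : ℕ) (x : ℝ × ℝ) : ∃ V, IsOpen V ∧ x ∈ V ∧
    ∀ y ∈ V, ∀ w : B.Word n, y ∈ B.cell w → x ∈ B.cell w := by
  refine ⟨(⋃ w ∈ {w : B.Word n | x ∉ B.cell w}, B.cell w)ᶜ, ?_, ?_, ?_⟩
  · exact ((toFinite _).isClosed_biUnion fun w _ => (B.isCompact_cell w).isClosed).isOpen_compl
  · simp
  · intro y hy w hw
    by_contra hx
    exact hy (mem_biUnion hx hw)

/-- If a connected set is separated away from `x`, both parts accumulate at `x`. -/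
theorem exists_mem_of_separation {X : Type*} [TopologicalSpace X] [T1Space X] {U a b V : Set X}
    {x : X} (hU : IsPreconnected U) (ha : IsOpen a) (hb : IsOpen b) (hV : IsOpen V) (hx : x ∈ V)
    (hxU : x ∈ U) (hab : U \ {x} ⊆ a ∪ b) (hne : ((U \ {x}) ∩ a).Nonempty)
    (hd : (U \ {x}) ∩ (a ∩ b) = ∅) : ∃ y ∈ V, y ∈ U \ {x} ∧ y ∈ a := by
  by_contra! h
  obtain ⟨z, hz, hza⟩ := hne
  -- If `V` missed the part in `a`, then `x` could be joined to the `b` side and `U` itself would be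
  -- separated.
  obtain ⟨y, hyU, ⟨hya, hyx⟩, hy⟩ := hU (a \ {x}) (b ∪ V) (ha.sdiff isClosed_singleton)
    (hb.union hV) (fun y hy => by
      by_cases hyx : y = x
      · exact Or.inr (Or.inr (hyx ▸ hx))
      · exact (hab ⟨hy, hyx⟩).imp (fun h => ⟨h, hyx⟩) Or.inl)
    ⟨z, hz.1, hza, hz.2⟩ ⟨x, hxU, Or.inr hx⟩
  rcases hy with hy | hy
  · exact (hd ▸ (⟨⟨hyU, hyx⟩, hya, hy⟩ : y ∈ (U \ {x}) ∩ (a ∩ b)) : y ∈ (∅ : Set X))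
  · exact h y hy ⟨hyU, hyx⟩ hya

theorem exists_splits_of_isLocalCutPoint (hconn : IsConnected B.carpet)
    (hcut : ¬ ∃ x, IsCutPoint B.carpet x) {x : ℝ × ℝ} (h : IsLocalCutPoint B.carpet x) :
    ∃ n, B.Splits (n + 2) x := by
  obtain ⟨U, hUK, hU, hUc, hxU, hUx⟩ := h
  obtain ⟨ε, hε, hεU⟩ := Metric.mem_nhdsWithin_iff.1 hU
  obtain ⟨n, hn⟩ := B.exists_level_cell_subset hε
  have hcell : ∀ w : B.Word (n + 2), x ∈ B.cell w → B.cell w ⊆ U := fun w hw y hy =>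
    hεU ⟨hn w x hw hy, B.iUnion_cell (n + 2) ▸ mem_iUnion.2 ⟨w, hy⟩⟩
  obtain ⟨V, hVo, hxV, hV⟩ := B.exists_isOpen_cells (n + 2) x
  rw [IsPreconnected] at hUx
  push Not at hUx
  obtain ⟨a, b, ha, hb, hab, hane, hbne, hd⟩ := hUx
  have hside : ∀ w : B.Word (n + 2), x ∈ B.cell w → B.cell w \ {x} ⊆ a ∨ B.cell w \ {x} ⊆ b := by
    intro w hw
    have hsub : B.cell w \ {x} ⊆ U \ {x} := sdiff_subset_sdiff_left (hcell w hw)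
    exact isPreconnected_iff_subset_of_disjoint.1 (isPreconnected_cell_diff hconn hcut hw) a b ha
      hb (hsub.trans hab) (subset_empty_iff.1 (hd ▸ inter_subset_inter_left _ hsub))
  have hdis : ∀ y ∈ U, y ≠ x → y ∈ a → y ∉ b := fun y hy hyx hya hyb =>
    (hd ▸ (⟨⟨hy, hyx⟩, hya, hyb⟩ : y ∈ (U \ {x}) ∩ (a ∩ b)) : y ∈ (∅ : Set (ℝ × ℝ)))
  have hcover : ∀ y ∈ U, ∃ w : B.Word (n + 2), y ∈ B.cell w := fun y hy =>
    mem_iUnion.1 (B.iUnion_cell (n + 2) ▸ hUK hy)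
  -- Neither class is empty: both sides accumulate at `x`, and near `x` only cells through `x`
  -- occur.
  refine ⟨n, {w | B.cell w \ {x} ⊆ a}, ?_, ?_, ?_⟩
  · obtain ⟨y, hyV, ⟨hyU, hyx⟩, hya⟩ := exists_mem_of_separation hUc.isPreconnected ha hb hVo hxV
      hxU hab hane hd
    obtain ⟨w, hyw⟩ := hcover y hyU
    have hxw := hV y hyV w hyw
    exact ⟨w, (hside w hxw).resolve_right fun h => hdis y hyU hyx hya (h ⟨hyw, hyx⟩), hxw⟩
  · obtain ⟨y, hyV, ⟨hyU, hyx⟩, hyb⟩ := exists_mem_of_separation hUc.isPreconnected hb ha hVo hxV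
      hxU (union_comm a b ▸ hab) hbne (inter_comm a b ▸ hd)
    obtain ⟨w, hyw⟩ := hcover y hyU
    exact ⟨w, fun h => hdis y hyU hyx (h ⟨hyw, hyx⟩) hyb, hV y hyV w hyw⟩
  · intro w hwa v hva hw hv y ⟨hyw, hyv⟩
    by_contra hyx
    exact hdis y (hcell w hw hyw) hyx (hwa ⟨hyw, hyx⟩) ((hside v hv).resolve_left hva ⟨hyv, hyx⟩)

theorem Splits.exists_partition {n : ℕ} {x : ℝ × ℝ} (h : B.Splits n x) :
    ∃ I J : Set (B.Word n), Disjoint I J ∧ (⋃ w ∈ I, B.cell w) ∩ (⋃ w ∈ J, B.cell w) = {x} ∧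
      I ∪ J = {w : B.Word n | x ∈ B.cell w} := by
  obtain ⟨I, ⟨w, hwI, hw⟩, ⟨v, hvI, hv⟩, hI⟩ := h
  refine ⟨{w | x ∈ B.cell w} ∩ I, {w | x ∈ B.cell w} \ I, disjoint_sdiff_inter.symm, ?_,
    inter_union_sdiff _ _⟩
  apply Subset.antisymm
  · rintro y ⟨hy, hy'⟩
    obtain ⟨w, ⟨hw, hwI⟩, hyw⟩ := mem_iUnion₂.1 hy
    obtain ⟨v, ⟨hv, hvI⟩, hyv⟩ := mem_iUnion₂.1 hy'
    exact hI w hwI v hvI hw hv ⟨hyw, hyv⟩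
  · rintro _ rfl
    exact ⟨mem_iUnion₂.2 ⟨w, ⟨hw, hwI⟩, hw⟩, mem_iUnion₂.2 ⟨v, ⟨hv, hvI⟩, hv⟩⟩

/-- The cells through `x` are connected with `x` in common, so their union is connected. Without `x`
it is covered by two closed unions that no longer meet, each keeping a point since no cell is a
singleton. -/
theorem isLocalCutPoint_of_partition (hconn : IsConnected B.carpet) {n : ℕ} {x : ℝ × ℝ}
    {I J : Set (B.Word n)} (hx : (⋃ w ∈ I, B.cell w) ∩ (⋃ w ∈ J, B.cell w) = {x})
    (hIJ : I ∪ J = {w : B.Word n | x ∈ B.cell w}) : IsLocalCutPoint B.carpet x := by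
  have hclosed : ∀ S : Set (B.Word n), IsClosed (⋃ w ∈ S, B.cell w) := fun S =>
    (toFinite S).isClosed_biUnion fun w _ => (B.isCompact_cell w).isClosed
  have hpoint : ∀ S : Set (B.Word n), x ∈ ⋃ w ∈ S, B.cell w →
      ∃ y ∈ ⋃ w ∈ S, B.cell w, y ≠ x := by
    intro S hS
    obtain ⟨w, hw, -⟩ := mem_iUnion₂.1 hS
    obtain ⟨y, hy, hyx⟩ := B.exists_mem_cell_ne w x
    exact ⟨y, mem_biUnion hw hy, hyx⟩
  have hxIJ : x ∈ (⋃ w ∈ I, B.cell w) ∩ (⋃ w ∈ J, B.cell w) := hx ▸ mem_singleton x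
  have hU : (⋃ w ∈ I ∪ J, B.cell w) = (⋃ w ∈ I, B.cell w) ∪ ⋃ w ∈ J, B.cell w :=
    biUnion_union I J _
  have hxU : x ∈ ⋃ w ∈ I ∪ J, B.cell w := hU ▸ Or.inl hxIJ.1
  refine ⟨⋃ w ∈ I ∪ J, B.cell w, ?_, ?_, ⟨⟨x, hxU⟩, ?_⟩, hxU, ?_⟩
  · rw [← B.iUnion_cell n]
    exact iUnion₂_subset fun w _ => subset_iUnion _ w
  · obtain ⟨V, hVo, hxV, hV⟩ := B.exists_isOpen_cells n x
    refine mem_nhdsWithin.2 ⟨V, hVo, hxV, ?_⟩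
    rintro y ⟨hyV, hyK⟩
    rw [← B.iUnion_cell n] at hyK
    obtain ⟨w, hw⟩ := mem_iUnion.1 hyK
    exact mem_biUnion (hIJ ▸ hV y hyV w hw : w ∈ I ∪ J) hw
  · rw [hIJ]
    refine isPreconnected_of_forall x fun y hy => ?_
    obtain ⟨w, hw, hyw⟩ := mem_iUnion₂.1 hy
    exact ⟨B.cell w, subset_biUnion_of_mem (u := fun w => B.cell w) hw, hw, hyw,
      hconn.isPreconnected.image _ (B.continuous_wordMap n w).continuousOn⟩
  · intro hpre
    obtain ⟨y, hyI, hyx⟩ := hpoint I hxIJ.1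
    obtain ⟨z, hzJ, hzx⟩ := hpoint J hxIJ.2
    obtain ⟨t, ⟨-, htx⟩, ht⟩ := isPreconnected_closed_iff.1 hpre _ _ (hclosed I) (hclosed J)
      (hU ▸ sdiff_subset) ⟨y, ⟨hU ▸ Or.inl hyI, hyx⟩, hyI⟩ ⟨z, ⟨hU ▸ Or.inr hzJ, hzx⟩, hzJ⟩
    rw [hx] at ht
    exact htx ht

end BaranskiData

theorem mainTheorem11 (B : BaranskiData) (hconn : IsConnected B.carpet)
    (hcut : ¬ ∃ x, IsCutPoint B.carpet x) :
    (∃ x, IsLocalCutPoint B.carpet x) ↔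
      ∃ n : ℕ, (n = 1 ∨ n = 2) ∧ ∃ I J : Set (B.Word n), Disjoint I J ∧
        ∃ x : ℝ × ℝ, (⋃ w ∈ I, B.cell w) ∩ (⋃ w ∈ J, B.cell w) = {x} ∧
          I ∪ J = {w : B.Word n | x ∈ B.cell w} := by
  constructor
  · rintro ⟨x, hx⟩
    obtain ⟨n, hn⟩ := BaranskiData.exists_splits_of_isLocalCutPoint hconn hcut hx
    obtain ⟨x', h⟩ := hn.exists_level_two
    obtain ⟨I, J, hIJ, h1, h2⟩ := h.exists_partition
    exact ⟨2, Or.inr rfl, I, J, hIJ, x', h1, h2⟩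
  · rintro ⟨n, -, I, J, -, x, h1, h2⟩
    exact ⟨x, BaranskiData.isLocalCutPoint_of_partition hconn h1 h2⟩
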